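/- **Proposition 4.2 ($q$-integral representation).** Let $0<q<1$, let $-\infty\le a,b\le\infty$, and write $\int_I f\,d_qx=\int_0^b f\,d_qx-\int_0^a f\,d_qx$ for the Jackson integral over $I=[a,b]$, where $$\int_0^{e} f\,d_qx=(1-q)\sum_{s\ge 0}e q^sf(eq^s)\quad(e\in\mathbb R),\qquad \int_0^{\pm\infty} f\,d_qx=\pm(1-q)\sum_{s\in\mathbb Z}q^sf(\pm q^s);$$ $\int_{I^n}$ denotes the $n$-fold iterated Jackson integral. Let $\omega:\mathbb R\to\mathbb R$ be a weight such that for every $k\ge0$ the series defining $\int_0^a x^k\omega(x)\,d_qx$ and $\int_0^b x^k\omega(x)\,d_qx$ converge absolutely. Put $$\Delta_q^4(x)=\prod_{1\le j<k\le n}(x_j-x_k)^2(x_j-qx_k)(x_j-q^{-1}x_k),\qquad \tau_{2n}=\frac1{n!}\int_{I^n}\Delta_q^4(x)\prod_{i=1}^n\omega(x_i)\,d_qx_i,$$ and assume $\tau_{2n}\ne0$ for all $n\ge0$. Let $D_qf(x)=\frac{f(x)-f(qx)}{(1-q)x}$ and $$\langle f,g\rangle=\int_I\bigl(f(x)D_qg(x)-g(x)D_qf(x)\bigr)\omega(x)\,d_qx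 .$$ Call a sequence of real monic polynomials $Q_0,Q_1,\dots$ with $\deg Q_n=n$ *$q$-skew orthogonal* if there are real numbers $u_n$ with $\langle Q_{2n},Q_{2m+1}\rangle=-\langle Q_{2m+1},Q_{2n}\rangle=u_n\delta_{n,m}$ and $\langle Q_{2m},Q_{2n}\rangle=\langle Q_{2m+1},Q_{2n+1}\rangle=0$ for all $m,n\ge0$. Then: 1. For all $n\ge 0$, $\ \mathrm{Pf}\bigl[\langle x^i,x^j\rangle\bigr]_{i,j=0}^{2n-1}=q^{n(n-1)}\,\tau_{2n}$. 2. A sequence of real polynomials $(Q_n)_{n\ge0}$ is a monic $q$-skew orthogonal sequence if and only if for all $n\ge0$ $$Q_{2n}(x)=\frac{1}{n!\,\tau_{2n}}\int_{I^n}\Delta_q^4(y)\prod_{i=1}^n(x-y_i)(x-qy_i)\,\omega(y_i)\,d_qy_i$$ and there are real constants $c_n$ with, for all $n\ge0$, $$Q_{2n+1}(x)=\frac{1}{n!\,\tau_{2n}}\int_{I^n}\Delta_q^4(y)\Bigl(x+(1+q)\sum_{i=1}^ny_i+c_n\Bigr)\prod_{i=1}^n(x-y_i)(x-qy_i)\,\omega(y_i)\,d_qy_i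 .$$ In particular, the constants $c_n$ may be chosen arbitrarily. -/

import Mathlib

open Polynomial

/-- The `q`-difference operator `D_q f(x) = (f(x) - f(qx)) / ((1-q)x)`. -/
noncomputable def qDiff (q : ℝ) (f : ℝ → ℝ) (x : ℝ) : ℝ :=
  (f x - f (q * x)) / ((1 - q) * x)

/-- The Jackson `q`-integral `∫_0^e f(x) d_q x` for an endpoint `e ∈ [-∞, ∞]`. -/
noncomputable def jacksonFromZero (q : ℝ) (f : ℝ → ℝ) : EReal → ℝ
  | ⊥ => -((1 - q) * ∑' s : ℤ, q ^ s * f (-q ^ s))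
  | ⊤ => (1 - q) * ∑' s : ℤ, q ^ s * f (q ^ s)
  | (a : ℝ) => (1 - q) * ∑' s : ℕ, a * q ^ s * f (a * q ^ s)

/-- Absolute convergence of the series that defines `∫_0^e f(x) d_q x`. -/
def JacksonSummable (q : ℝ) (f : ℝ → ℝ) : EReal → Prop
  | ⊥ => Summable fun s : ℤ => q ^ s * f (-q ^ s)
  | ⊤ => Summable fun s : ℤ => q ^ s * f (q ^ s)
  | (a : ℝ) => Summable fun s : ℕ => a * q ^ s * f (a * q ^ s)

/-- The Jackson `q`-integral `∫_a^b f(x) d_q x = ∫_0^b f(x) d_q x - ∫_0^a f(x) d_q x`. -/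
noncomputable def jacksonIntegral (q : ℝ) (a b : EReal) (f : ℝ → ℝ) : ℝ :=
  jacksonFromZero q f b - jacksonFromZero q f a

/-- The `n`-fold Jackson integral `∫_{I^n} F(x_1, …, x_n) d_q x_1 ⋯ d_q x_n` over `I = [a, b]`. -/
noncomputable def jacksonIntegralPi (q : ℝ) (a b : EReal) :
    (n : ℕ) → ((Fin n → ℝ) → ℝ) → ℝ
  | 0, F => F ![]
  | n + 1, F => jacksonIntegral q a b fun y =>
      jacksonIntegralPi q a b n fun v => F (Fin.cons y v)

/-- All moments of the weight `ω` on `I = [a, b]` converge absolutely. -/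
def HasJacksonMoments (q : ℝ) (a b : EReal) (ω : ℝ → ℝ) : Prop :=
  ∀ k : ℕ, JacksonSummable q (fun x => x ^ k * ω x) a ∧
    JacksonSummable q (fun x => x ^ k * ω x) b

/-- The product `∏_{j<k} (x_j - x_k)² (x_j - q x_k) (x_j - q⁻¹ x_k)`. -/
noncomputable def qDelta4 (q : ℝ) {n : ℕ} (x : Fin n → ℝ) : ℝ :=
  ∏ j : Fin n, ∏ k ∈ Finset.Ioi j,
    ((x j - x k) ^ 2 * (x j - q * x k) * (x j - q⁻¹ * x k))

/-- The partition function `τ_{2n}` of the `n`-particle `q`-symplectic ensemble. -/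
noncomputable def qTau (q : ℝ) (a b : EReal) (ω : ℝ → ℝ) (n : ℕ) : ℝ :=
  1 / (n.factorial : ℝ) *
    jacksonIntegralPi q a b n fun x => qDelta4 q x * ∏ i, ω (x i)

/-- The skew inner product `⟨f, g⟩ = ∫_I (f D_q g - g D_q f) ω d_q x`. -/
noncomputable def qSkewInner (q : ℝ) (a b : EReal) (ω : ℝ → ℝ) (f g : ℝ[X]) : ℝ :=
  jacksonIntegral q a b fun x =>
    (f.eval x * qDiff q (fun y => g.eval y) x
      - g.eval x * qDiff q (fun y => f.eval y) x) * ω x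

/-- `Q_0, Q_1, …` is a system of monic `q`-skew orthogonal polynomials, `deg Q_n = n`. -/
def IsQSkewOrthogonal (q : ℝ) (a b : EReal) (ω : ℝ → ℝ) (Q : ℕ → ℝ[X]) : Prop :=
  (∀ n, (Q n).Monic ∧ (Q n).natDegree = n) ∧
  ∃ u : ℕ → ℝ, ∀ m n : ℕ,
    qSkewInner q a b ω (Q (2 * n)) (Q (2 * m + 1)) = (if n = m then u n else 0) ∧
    qSkewInner q a b ω (Q (2 * m + 1)) (Q (2 * n)) = -(if n = m then u n else 0) ∧
    qSkewInner q a b ω (Q (2 * m)) (Q (2 * n)) = 0 ∧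
    qSkewInner q a b ω (Q (2 * m + 1)) (Q (2 * n + 1)) = 0

/-- The Pfaffian of a `2n × 2n` skew-symmetric matrix,
`(2^n n!)⁻¹ ∑_σ sgn(σ) ∏_{i<n} A_{σ(2i), σ(2i+1)}`. -/
noncomputable def pfaffian {n : ℕ} (A : Matrix (Fin (2 * n)) (Fin (2 * n)) ℝ) : ℝ :=
  1 / (2 ^ n * (n.factorial : ℝ)) *
    ∑ σ : Equiv.Perm (Fin (2 * n)), ((Equiv.Perm.sign σ : ℤ) : ℝ) *
      ∏ i : Fin n, A (σ ⟨2 * i, by omega⟩) (σ ⟨2 * i + 1, by omega⟩)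

/-- The leading `2n × 2n` block of the moment matrix `m_{i,j} = ⟨x^i, x^j⟩`. -/
noncomputable def qMomentMatrix (q : ℝ) (a b : EReal) (ω : ℝ → ℝ) (n : ℕ) :
    Matrix (Fin (2 * n)) (Fin (2 * n)) ℝ :=
  Matrix.of fun i j => qSkewInner q a b ω (X ^ (i : ℕ)) (X ^ (j : ℕ))

section

open Equiv

/-! Expanding `D_q` turns the integrand of `⟨f, g⟩` into the 2×2 determinant `f(qx) g(x) - f(x)
g(qx)` times `ω(x) / ((1-q)x)`. A Pfaffian-type sum of products of skew inner products of
polynomials `f_j` is therefore an `n`-fold integral of the determinant of the values of the `f_j` at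
the nodes `q y_i, y_i` (de Bruijn, `sum_sign_mul_prod_qSkewInner`). For monomials this is a
Vandermonde determinant, equal to `q^(n(n-1)) Δ_q^4(y) ∏ (1-q) y_i` (`det_vandermonde_qNodes`); the
last product cancels the denominators, and the Pfaffian formula follows.

Since `τ_{2n} ≠ 0`, the same computation with one monomial replaced by `p` shows that the form is
nondegenerate in degree `< 2n`. Hence each class `g + (degree < 2n)` contains at most one polynomial
orthogonal to `1, …, X^(2n-1)`. One is given by expanding an odd-size Pfaffian with `g` as last
element. De Bruijn's formula with an extra row of values at `x` evaluates it as the integral of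
`Δ_q^4(y) G_y(x) ∏ ω(y_i)`, where `G_y` lies in the class of `g` and vanishes at all nodes.

Because the form is alternating, skew orthogonality of a monic sequence only asks that `Q_{2n}` and
`Q_{2n+1}` be orthogonal to degree `< 2n`. The classes are those of `X^(2n)` and `X^(2n+1) + c
X^(2n)`, with `c` free. -/

/-! ### Linearity of Jackson integrals and their insensitivity to the origin -/

theorem jacksonFromZero_bot (q : ℝ) (f : ℝ → ℝ) :
    jacksonFromZero q f ⊥ = -((1 - q) * ∑' s : ℤ, q ^ s * f (-q ^ s)) := rfl

theorem jacksonFromZero_top (q : ℝ) (f : ℝ → ℝ) :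
    jacksonFromZero q f ⊤ = (1 - q) * ∑' s : ℤ, q ^ s * f (q ^ s) := rfl

theorem jacksonFromZero_coe (q : ℝ) (f : ℝ → ℝ) (a : ℝ) :
    jacksonFromZero q f a = (1 - q) * ∑' s : ℕ, a * q ^ s * f (a * q ^ s) := rfl

theorem jacksonFromZero_sum {q : ℝ} {T : Type*} (S : Finset T) (c : T → ℝ) (g : T → ℝ → ℝ)
    (e : EReal) (hg : ∀ t ∈ S, JacksonSummable q (g t) e) :
    jacksonFromZero q (fun x => ∑ t ∈ S, c t * g t x) e =
      ∑ t ∈ S, c t * jacksonFromZero q (g t) e := by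
  have key : ∀ {J : Type} (w p : J → ℝ), (∀ t ∈ S, Summable fun s => w s * g t (p s)) →
      ∑' s, w s * ∑ t ∈ S, c t * g t (p s) = ∑ t ∈ S, c t * ∑' s, w s * g t (p s) := by
    intro J w p h
    simp_rw [← tsum_mul_left, Finset.mul_sum]
    rw [← Summable.tsum_finsetSum fun t ht => (h t ht).mul_left (c t)]
    refine tsum_congr fun s => Finset.sum_congr rfl fun t _ => by ring
  induction e with
  | bot =>
    simp only [jacksonFromZero_bot]
    rw [key (fun s : ℤ => q ^ s) (fun s => -q ^ s) hg, Finset.mul_sum, ← Finset.sum_neg_distrib]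
    exact Finset.sum_congr rfl fun t _ => by ring
  | top =>
    simp only [jacksonFromZero_top]
    rw [key (fun s : ℤ => q ^ s) (fun s => q ^ s) hg, Finset.mul_sum]
    exact Finset.sum_congr rfl fun t _ => by ring
  | coe a =>
    simp only [jacksonFromZero_coe]
    rw [key (fun s : ℕ => a * q ^ s) (fun s => a * q ^ s) hg, Finset.mul_sum]
    exact Finset.sum_congr rfl fun t _ => by ring

theorem JacksonSummable.sum {q : ℝ} {T : Type*} (S : Finset T) (c : T → ℝ) (g : T → ℝ → ℝ)
    {e : EReal} (hg : ∀ t ∈ S, JacksonSummable q (g t) e) :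
    JacksonSummable q (fun x => ∑ t ∈ S, c t * g t x) e := by
  have key : ∀ {J : Type} (w p : J → ℝ), (∀ t ∈ S, Summable fun s => w s * g t (p s)) →
      Summable fun s => w s * ∑ t ∈ S, c t * g t (p s) := by
    intro J w p h
    refine (summable_sum fun t ht => (h t ht).mul_left (c t)).congr fun s => ?_
    rw [Finset.mul_sum]
    exact Finset.sum_congr rfl fun t _ => by ring
  induction e with
  | bot => exact key (fun s : ℤ => q ^ s) (fun s => -q ^ s) hg
  | top => exact key (fun s : ℤ => q ^ s) (fun s => q ^ s) hg
  | coe a => exact key (fun s : ℕ => a * q ^ s) (fun s => a * q ^ s) hg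

/-- A node at a finite endpoint carries itself as weight, and the nodes `±q^s` never vanish, so the
value at 0 does not count. This permits the factor `1/x` in the skew kernel. -/
theorem JacksonSummable.congr_of_ne_zero {q : ℝ} (hq : q ≠ 0) {f g : ℝ → ℝ} {e : EReal}
    (hf : JacksonSummable q f e) (h : ∀ x, x ≠ 0 → f x = g x) : JacksonSummable q g e := by
  induction e with
  | bot =>
    refine Summable.congr hf fun s => ?_
    rw [h _ (neg_ne_zero.mpr (zpow_ne_zero s hq))]
  | top =>
    refine Summable.congr hf fun s => ?_
    rw [h _ (zpow_ne_zero s hq)]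
  | coe a =>
    refine Summable.congr hf fun s => ?_
    by_cases h0 : a * q ^ s = 0
    · simp [h0]
    · rw [h _ h0]

/-- Absolute convergence of the Jackson integral of `g` at both endpoints of `[a, b]`. -/
def JacksonIntegrable (q : ℝ) (a b : EReal) (g : ℝ → ℝ) : Prop :=
  JacksonSummable q g a ∧ JacksonSummable q g b

theorem jacksonIntegral_sum {q : ℝ} {a b : EReal} {T : Type*} (S : Finset T) (c : T → ℝ)
    (g : T → ℝ → ℝ) (hg : ∀ t ∈ S, JacksonIntegrable q a b (g t)) :
    jacksonIntegral q a b (fun x => ∑ t ∈ S, c t * g t x) =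
      ∑ t ∈ S, c t * jacksonIntegral q a b (g t) := by
  unfold jacksonIntegral
  rw [jacksonFromZero_sum S c g b fun t ht => (hg t ht).2,
    jacksonFromZero_sum S c g a fun t ht => (hg t ht).1, ← Finset.sum_sub_distrib]
  exact Finset.sum_congr rfl fun t _ => by ring

/-- Finite sums of products of one-variable functions need only linearity, not Fubini. -/
theorem jacksonIntegralPi_sum_prod {q : ℝ} {a b : EReal} {T : Type*} (S : Finset T) (n : ℕ)
    (c : T → ℝ) (g : T → Fin n → ℝ → ℝ)
    (hg : ∀ t ∈ S, ∀ i, JacksonIntegrable q a b (g t i)) :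
    jacksonIntegralPi q a b n (fun y => ∑ t ∈ S, c t * ∏ i, g t i (y i)) =
      ∑ t ∈ S, c t * ∏ i, jacksonIntegral q a b (g t i) := by
  induction n generalizing c with
  | zero => simp [jacksonIntegralPi]
  | succ n ih =>
    simp only [jacksonIntegralPi, Fin.prod_univ_succ, Fin.cons_zero, Fin.cons_succ]
    have h1 : ∀ y : ℝ, (jacksonIntegralPi q a b n fun v =>
        ∑ t ∈ S, c t * (g t 0 y * ∏ i : Fin n, g t i.succ (v i))) =
        ∑ t ∈ S, (c t * ∏ i : Fin n, jacksonIntegral q a b (g t i.succ)) * g t 0 y := by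
      intro y
      simp_rw [← mul_assoc]
      -- With the outer variable frozen, its factor joins the coefficient; hence the induction over
      -- all `c`.
      rw [ih (fun t => c t * g t 0 y) (fun t i => g t i.succ) fun t ht i => hg t ht _]
      exact Finset.sum_congr rfl fun t _ => by ring
    simp_rw [h1]
    rw [jacksonIntegral_sum S _ (fun t => g t 0) fun t ht => hg t ht 0]
    exact Finset.sum_congr rfl fun t _ => by ring

/-- Holds without convergence: for `c ≠ 0` scaling preserves divergence, where `tsum` is 0 by
default, and for `c = 0` both sides vanish. -/
theorem jacksonFromZero_const_mul (q c : ℝ) (f : ℝ → ℝ) (e : EReal) :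
    jacksonFromZero q (fun x => c * f x) e = c * jacksonFromZero q f e := by
  induction e with
  | bot =>
    simp only [jacksonFromZero_bot, mul_left_comm _ c, tsum_mul_left]
    ring
  | top => simp only [jacksonFromZero_top, mul_left_comm _ c, tsum_mul_left]
  | coe a => simp only [jacksonFromZero_coe, mul_left_comm _ c, tsum_mul_left]

theorem jacksonIntegral_const_mul (q c : ℝ) (a b : EReal) (f : ℝ → ℝ) :
    jacksonIntegral q a b (fun x => c * f x) = c * jacksonIntegral q a b f := by
  simp only [jacksonIntegral, jacksonFromZero_const_mul, mul_sub]

theorem jacksonIntegralPi_const_mul (q c : ℝ) (a b : EReal) (n : ℕ) (F : (Fin n → ℝ) → ℝ) :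
    jacksonIntegralPi q a b n (fun y => c * F y) = c * jacksonIntegralPi q a b n F := by
  induction n with
  | zero => rfl
  | succ n ih => simp only [jacksonIntegralPi, ih, jacksonIntegral_const_mul]

theorem jacksonFromZero_congr_of_ne_zero {q : ℝ} (hq : q ≠ 0) {f g : ℝ → ℝ} (e : EReal)
    (h : ∀ x, x ≠ 0 → f x = g x) : jacksonFromZero q f e = jacksonFromZero q g e := by
  induction e with
  | bot =>
    simp only [jacksonFromZero_bot]
    congr 2
    exact tsum_congr fun s => by rw [h _ (neg_ne_zero.mpr (zpow_ne_zero s hq))]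
  | top =>
    simp only [jacksonFromZero_top]
    congr 1
    exact tsum_congr fun s => by rw [h _ (zpow_ne_zero s hq)]
  | coe a =>
    simp only [jacksonFromZero_coe]
    congr 1
    refine tsum_congr fun s => ?_
    by_cases h0 : a * q ^ s = 0
    · simp [h0]
    · rw [h _ h0]

theorem jacksonIntegralPi_congr_of_ne_zero {q : ℝ} (hq : q ≠ 0) (a b : EReal) {n : ℕ}
    {F G : (Fin n → ℝ) → ℝ} (h : ∀ y, (∀ i, y i ≠ 0) → F y = G y) :
    jacksonIntegralPi q a b n F = jacksonIntegralPi q a b n G := by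
  induction n with
  | zero => exact h _ fun i => i.elim0
  | succ n ih =>
    have key : ∀ y : ℝ, y ≠ 0 → jacksonIntegralPi q a b n (fun v => F (Fin.cons y v)) =
        jacksonIntegralPi q a b n (fun v => G (Fin.cons y v)) := fun y hy =>
      ih fun v hv => h _ fun i => by
        refine Fin.cases ?_ (fun i => ?_) i
        · simpa using hy
        · simpa using hv i
    simp only [jacksonIntegralPi, jacksonIntegral]
    rw [jacksonFromZero_congr_of_ne_zero hq a key, jacksonFromZero_congr_of_ne_zero hq b key]

/-! ### The skew inner product as an alternating bilinear form -/

/-- The integrand of the skew inner product, in the form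
`(f(qx) g(x) - f(x) g(qx)) ω(x) / ((1-q)x)`. -/
noncomputable def qSkewKernel (q : ℝ) (ω : ℝ → ℝ) (f g : ℝ[X]) (x : ℝ) : ℝ :=
  (f.eval (q * x) * g.eval x - f.eval x * g.eval (q * x)) * (ω x / ((1 - q) * x))

theorem qSkewInner_eq_integral_kernel (q : ℝ) (a b : EReal) (ω : ℝ → ℝ) (f g : ℝ[X]) :
    qSkewInner q a b ω f g = jacksonIntegral q a b (qSkewKernel q ω f g) := by
  unfold qSkewInner
  congr 1
  ext x
  simp only [qDiff, qSkewKernel]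
  ring

theorem jacksonIntegrable_eval_mul {q : ℝ} {a b : EReal} {ω : ℝ → ℝ}
    (hω : HasJacksonMoments q a b ω) (p : ℝ[X]) :
    JacksonIntegrable q a b fun x => p.eval x * ω x := by
  have h : (fun x => p.eval x * ω x) =
      fun x => ∑ k ∈ Finset.range (p.natDegree + 1), p.coeff k * (x ^ k * ω x) := by
    ext x
    rw [eval_eq_sum_range, Finset.sum_mul]
    exact Finset.sum_congr rfl fun k _ => by ring
  rw [h]
  exact ⟨JacksonSummable.sum _ _ _ fun k _ => (hω k).1,
    JacksonSummable.sum _ _ _ fun k _ => (hω k).2⟩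

/-- The numerator is a polynomial vanishing at 0, hence divisible by `X`; away from 0 the kernel is
a polynomial times `ω`, and the moment hypothesis applies. -/
theorem jacksonIntegrable_qSkewKernel {q : ℝ} (hq : q ≠ 0) {a b : EReal} {ω : ℝ → ℝ}
    (hω : HasJacksonMoments q a b ω) (f g : ℝ[X]) :
    JacksonIntegrable q a b (qSkewKernel q ω f g) := by
  set p : ℝ[X] := f.comp (C q * X) * g - f * g.comp (C q * X) with hp
  have hp0 : p.coeff 0 = 0 := by
    rw [coeff_zero_eq_eval_zero]
    simp only [hp, eval_sub, eval_mul, eval_comp, eval_C, eval_X, mul_zero]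
    ring
  have hpx : ∀ x, p.divX.eval x * x =
      f.eval (q * x) * g.eval x - f.eval x * g.eval (q * x) := by
    intro x
    have h := congrArg (eval x) (divX_mul_X_add p)
    simpa [hp0, hp] using h
  have h := jacksonIntegrable_eval_mul hω (C (1 - q)⁻¹ * p.divX)
  have hcongr : ∀ x, x ≠ 0 →
      (C (1 - q)⁻¹ * p.divX).eval x * ω x = qSkewKernel q ω f g x := by
    intro x hx
    rw [qSkewKernel, ← hpx, eval_mul, eval_C, div_eq_mul_inv, mul_inv]
    field_simp
  exact ⟨h.1.congr_of_ne_zero hq hcongr, h.2.congr_of_ne_zero hq hcongr⟩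

theorem qSkewInner_swap (q : ℝ) (a b : EReal) (ω : ℝ → ℝ) (f g : ℝ[X]) :
    qSkewInner q a b ω f g = -qSkewInner q a b ω g f := by
  rw [qSkewInner_eq_integral_kernel, qSkewInner_eq_integral_kernel,
    ← neg_one_mul (jacksonIntegral _ _ _ _), ← jacksonIntegral_const_mul]
  congr 1
  ext x
  simp only [qSkewKernel]
  ring

theorem qSkewInner_self (q : ℝ) (a b : EReal) (ω : ℝ → ℝ) (f : ℝ[X]) :
    qSkewInner q a b ω f f = 0 := by
  linarith [qSkewInner_swap q a b ω f f]

/-- The skew inner product as a bilinear form on polynomials. -/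
noncomputable def qSkewForm {q : ℝ} (hq : q ≠ 0) {a b : EReal} {ω : ℝ → ℝ}
    (hω : HasJacksonMoments q a b ω) : ℝ[X] →ₗ[ℝ] ℝ[X] →ₗ[ℝ] ℝ :=
  have hadd : ∀ f g h : ℝ[X], qSkewInner q a b ω f (g + h) =
      qSkewInner q a b ω f g + qSkewInner q a b ω f h := by
    intro f g h
    have := jacksonIntegral_sum (q := q) (a := a) (b := b) Finset.univ (fun _ : Bool => 1)
      (fun t => cond t (qSkewKernel q ω f g) (qSkewKernel q ω f h)) (by
        rintro (_ | _) _ <;> exact jacksonIntegrable_qSkewKernel hq hω _ _)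
    simp only [Fintype.sum_bool, cond_true, cond_false, one_mul] at this
    simp only [qSkewInner_eq_integral_kernel]
    rw [← this]
    congr 1
    ext x
    simp only [qSkewKernel, eval_add]
    ring
  have hsmul : ∀ (c : ℝ) (f g : ℝ[X]), qSkewInner q a b ω f (c • g) =
      c • qSkewInner q a b ω f g := by
    intro c f g
    rw [qSkewInner_eq_integral_kernel, qSkewInner_eq_integral_kernel, smul_eq_mul,
      ← jacksonIntegral_const_mul]
    congr 1
    ext x
    simp only [qSkewKernel, eval_smul, smul_eq_mul]
    ring
  LinearMap.mk₂ ℝ (qSkewInner q a b ω)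
    (fun f g h => by
      rw [qSkewInner_swap, hadd, neg_add, ← qSkewInner_swap, ← qSkewInner_swap])
    (fun c f g => by rw [qSkewInner_swap, hsmul, ← smul_neg, ← qSkewInner_swap])
    hadd hsmul

theorem qSkewForm_apply {q : ℝ} (hq : q ≠ 0) {a b : EReal} {ω : ℝ → ℝ}
    (hω : HasJacksonMoments q a b ω) (f g : ℝ[X]) :
    qSkewForm hq hω f g = qSkewInner q a b ω f g := rfl

/-! ### Alternating sums over permutations and de Bruijn's formula -/

theorem sum_sign_mul_antisymm_pair {ι : Type*} [Fintype ι] [DecidableEq ι] {l r : ι} (hlr : l ≠ r)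
    (h : ι → ι → ℝ) (ρ : Perm ι → ℝ) (hρ : ∀ σ, ρ (σ * swap l r) = ρ σ) :
    ∑ σ : Perm ι, ((Perm.sign σ : ℤ) : ℝ) * ((h (σ l) (σ r) - h (σ r) (σ l)) * ρ σ) =
      2 * ∑ σ : Perm ι, ((Perm.sign σ : ℤ) : ℝ) * (h (σ l) (σ r) * ρ σ) := by
  have key : ∑ σ : Perm ι, ((Perm.sign σ : ℤ) : ℝ) * (h (σ r) (σ l) * ρ σ) =
      -∑ σ : Perm ι, ((Perm.sign σ : ℤ) : ℝ) * (h (σ l) (σ r) * ρ σ) := by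
    rw [← Equiv.sum_comp (Equiv.mulRight (swap l r)), ← Finset.sum_neg_distrib]
    refine Finset.sum_congr rfl fun σ _ => ?_
    simp [hρ, Perm.sign_swap hlr]
  simp only [sub_mul, mul_sub, Finset.sum_sub_distrib, key]
  ring

/-- Each factor of an alternating sum of products over disjoint pairs may be antisymmetrized. -/
theorem sum_sign_mul_prod_antisymm {ι κ : Type*} [Fintype ι] [DecidableEq ι] [DecidableEq κ]
    (l r : κ → ι) (hlr : ∀ i, l i ≠ r i)
    (hdisj : ∀ i j, i ≠ j → l i ≠ l j ∧ l i ≠ r j ∧ r i ≠ l j ∧ r i ≠ r j)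
    (h : κ → ι → ι → ℝ) (S : Finset κ) (ρ : Perm ι → ℝ)
    (hρ : ∀ i ∈ S, ∀ σ, ρ (σ * swap (l i) (r i)) = ρ σ) :
    ∑ σ : Perm ι, ((Perm.sign σ : ℤ) : ℝ) *
        ((∏ i ∈ S, (h i (σ (l i)) (σ (r i)) - h i (σ (r i)) (σ (l i)))) * ρ σ) =
      2 ^ S.card * ∑ σ : Perm ι, ((Perm.sign σ : ℤ) : ℝ) *
        ((∏ i ∈ S, h i (σ (l i)) (σ (r i))) * ρ σ) := by
  have hfix : ∀ i j, i ≠ j → swap (l j) (r j) (l i) = l i ∧ swap (l j) (r j) (r i) = r i :=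
    fun i j hij => ⟨swap_apply_of_ne_of_ne (hdisj i j hij).1 (hdisj i j hij).2.1,
      swap_apply_of_ne_of_ne (hdisj i j hij).2.2.1 (hdisj i j hij).2.2.2⟩
  induction S using Finset.induction_on generalizing ρ with
  | empty => simp
  | insert i S hi ih =>
    simp only [Finset.prod_insert hi, Finset.card_insert_of_notMem hi, mul_assoc]
    rw [sum_sign_mul_antisymm_pair (hlr i) (h i) (fun σ =>
      (∏ j ∈ S, (h j (σ (l j)) (σ (r j)) - h j (σ (r j)) (σ (l j)))) * ρ σ)]
    -- The factor already treated moves into `ρ`; disjointness of the pairs keeps it invariant under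
    -- the remaining swaps.
    · have := ih (fun σ => h i (σ (l i)) (σ (r i)) * ρ σ) (by
        intro j hj σ
        have hij : i ≠ j := fun e => hi (e ▸ hj)
        simp only [Perm.mul_apply, (hfix i j hij).1, (hfix i j hij).2,
          hρ j (Finset.mem_insert_of_mem hj)])
      simp only [mul_left_comm _ (h i _ _)] at this ⊢
      rw [pow_succ', this, ← mul_assoc]
    · intro σ
      rw [hρ i (Finset.mem_insert_self i S)]
      congr 1
      refine Finset.prod_congr rfl fun j hj => ?_
      have hij : j ≠ i := fun e => hi (e ▸ hj)
      simp only [Perm.mul_apply, (hfix j i hij).1, (hfix j i hij).2]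

/-- The expansion vector of an odd-size Pfaffian is orthogonal to every vector of the family. -/
theorem sum_sign_mul_prod_mul_eq_zero {ι κ : Type*} [Fintype ι] [DecidableEq ι] [Fintype κ]
    [DecidableEq κ] (l r : κ → ι) (o : ι) (hlr : ∀ i, l i ≠ r i)
    (hdisj : ∀ i j, i ≠ j → l i ≠ l j ∧ l i ≠ r j ∧ r i ≠ l j ∧ r i ≠ r j)
    (hlo : ∀ i, l i ≠ o) (hro : ∀ i, r i ≠ o) (hcov : ∀ k, k = o ∨ ∃ i, k = l i ∨ k = r i)
    (B : ι → ι → ℝ) (hB : ∀ i j, B i j = -B j i) (j : ι) :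
    ∑ σ : Perm ι, ((Perm.sign σ : ℤ) : ℝ) * ((∏ i, B (σ (l i)) (σ (r i))) * B (σ o) j) = 0 := by
  -- Sort the permutations by the position `p` of `j`. If `p = o`, the factor `B j j` is 0.
  -- Otherwise swapping `o` with the partner of `p` preserves the product, by skew symmetry, and
  -- reverses the sign.
  rw [← Finset.sum_fiberwise (s := Finset.univ) (g := fun σ : Perm ι => σ.symm j)]
  refine Finset.sum_eq_zero fun p _ => ?_
  have key : ∀ m : ι, m ≠ o → p ≠ m → p ≠ o →
      (∀ σ : Perm ι, σ p = j →
        (∏ i, B ((σ * swap m o) (l i)) ((σ * swap m o) (r i))) * B ((σ * swap m o) o) j =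
        (∏ i, B (σ (l i)) (σ (r i))) * B (σ o) j) →
      ∑ σ : Perm ι with σ.symm j = p, ((Perm.sign σ : ℤ) : ℝ) *
        ((∏ i, B (σ (l i)) (σ (r i))) * B (σ o) j) = 0 := by
    intro m hmo hpm hpo hT
    have : ∑ σ : Perm ι with σ.symm j = p, ((Perm.sign σ : ℤ) : ℝ) *
        ((∏ i, B (σ (l i)) (σ (r i))) * B (σ o) j) =
        -∑ σ : Perm ι with σ.symm j = p, ((Perm.sign σ : ℤ) : ℝ) *
        ((∏ i, B (σ (l i)) (σ (r i))) * B (σ o) j) := by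
      rw [← Finset.sum_neg_distrib]
      refine Finset.sum_equiv (Equiv.mulRight (swap m o)) ?_ ?_
      · intro σ
        simp only [Finset.mem_filter, Finset.mem_univ, true_and, Equiv.symm_apply_eq,
          Equiv.coe_mulRight, Perm.mul_apply, swap_apply_of_ne_of_ne hpm hpo]
      · intro σ hσ
        have hσ' : σ p = j := ((Equiv.symm_apply_eq _).mp (Finset.mem_filter.mp hσ).2).symm
        rw [Equiv.coe_mulRight, hT σ hσ', Perm.sign_mul, Perm.sign_swap hmo]
        simp
    linarith
  rcases hcov p with rfl | ⟨i, rfl | rfl⟩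
  · refine Finset.sum_eq_zero fun σ hσ => ?_
    have hσ' : σ p = j := ((Equiv.symm_apply_eq _).mp (Finset.mem_filter.mp hσ).2).symm
    have : B j j = 0 := by linarith [hB j j]
    rw [hσ', this]
    simp
  · refine key (r i) (hro i) (hlr i) (hlo i) fun σ hσ => ?_
    rw [← Finset.mul_prod_erase _ _ (Finset.mem_univ i),
      ← Finset.mul_prod_erase Finset.univ (fun i => B (σ (l i)) (σ (r i))) (Finset.mem_univ i)]
    have hrest : ∏ k ∈ Finset.univ.erase i, B ((σ * swap (r i) o) (l k)) ((σ * swap (r i) o) (r k))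
        = ∏ k ∈ Finset.univ.erase i, B (σ (l k)) (σ (r k)) := by
      refine Finset.prod_congr rfl fun k hk => ?_
      have hd := hdisj k i (Finset.ne_of_mem_erase hk)
      rw [Perm.mul_apply, Perm.mul_apply, swap_apply_of_ne_of_ne hd.2.1 (hlo k),
        swap_apply_of_ne_of_ne hd.2.2.2 (hro k)]
    rw [hrest]
    simp only [Perm.mul_apply, swap_apply_left, swap_apply_right,
      swap_apply_of_ne_of_ne (hlr i) (hlo i), hσ]
    rw [hB j (σ o), hB (σ (r i)) j]
    ring
  · refine key (l i) (hlo i) (hlr i).symm (hro i) fun σ hσ => ?_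
    rw [← Finset.mul_prod_erase _ _ (Finset.mem_univ i),
      ← Finset.mul_prod_erase Finset.univ (fun i => B (σ (l i)) (σ (r i))) (Finset.mem_univ i)]
    have hrest : ∏ k ∈ Finset.univ.erase i, B ((σ * swap (l i) o) (l k)) ((σ * swap (l i) o) (r k))
        = ∏ k ∈ Finset.univ.erase i, B (σ (l k)) (σ (r k)) := by
      refine Finset.prod_congr rfl fun k hk => ?_
      have hd := hdisj k i (Finset.ne_of_mem_erase hk)
      rw [Perm.mul_apply, Perm.mul_apply, swap_apply_of_ne_of_ne hd.1 (hlo k),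
        swap_apply_of_ne_of_ne hd.2.2.1 (hro k)]
    rw [hrest]
    simp only [Perm.mul_apply, swap_apply_left, swap_apply_right,
      swap_apply_of_ne_of_ne (hlr i).symm (hro i), hσ]
    ring

/-- De Bruijn's integration formula for the skew inner product. -/
theorem sum_sign_mul_prod_qSkewInner {q : ℝ} (hq : q ≠ 0) {a b : EReal} {ω : ℝ → ℝ}
    (hω : HasJacksonMoments q a b ω) {n : ℕ} {ι : Type*} [Fintype ι] [DecidableEq ι]
    (l r : Fin n → ι) (hlr : ∀ i, l i ≠ r i)
    (hdisj : ∀ i j, i ≠ j → l i ≠ l j ∧ l i ≠ r j ∧ r i ≠ l j ∧ r i ≠ r j)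
    (rest : Finset ι) (hrest : ∀ i, l i ∉ rest ∧ r i ∉ rest)
    (hprod : ∀ F : ι → ℝ, ∏ k, F k = (∏ i, F (l i) * F (r i)) * ∏ k ∈ rest, F k)
    (f : ι → ℝ[X]) (v : ι → ι → ℝ) (M : (Fin n → ℝ) → Matrix ι ι ℝ)
    (hMl : ∀ y i j, M y (l i) j = (f j).eval (q * y i))
    (hMr : ∀ y i j, M y (r i) j = (f j).eval (y i))
    (hMv : ∀ y, ∀ k ∈ rest, ∀ j, M y k j = v k j) :
    ∑ σ : Perm ι, ((Perm.sign σ : ℤ) : ℝ) *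
      ((∏ i, qSkewInner q a b ω (f (σ (l i))) (f (σ (r i)))) * ∏ k ∈ rest, v k (σ k)) =
    2 ^ n * jacksonIntegralPi q a b n fun y =>
      (M y).det * ∏ i, (ω (y i) / ((1 - q) * y i)) := by
  have hint : ∀ y : Fin n → ℝ, 2 ^ n * ((M y).det * ∏ i, (ω (y i) / ((1 - q) * y i))) =
      ∑ σ : Perm ι, (((Perm.sign σ : ℤ) : ℝ) * ∏ k ∈ rest, v k (σ k)) *
        ∏ i, qSkewKernel q ω (f (σ (l i))) (f (σ (r i))) (y i) := by
    intro y
    have h := sum_sign_mul_prod_antisymm l r hlr hdisj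
      (fun i j k => (f j).eval (q * y i) * (f k).eval (y i)) Finset.univ
      (fun σ => ∏ k ∈ rest, v k (σ k)) (by
        intro i _ σ
        refine Finset.prod_congr rfl fun k hk => ?_
        rw [Perm.mul_apply, swap_apply_of_ne_of_ne]
        · rintro rfl; exact (hrest i).1 hk
        · rintro rfl; exact (hrest i).2 hk)
    rw [Finset.card_univ, Fintype.card_fin] at h
    have hdet : (M y).det = ∑ σ : Perm ι, ((Perm.sign σ : ℤ) : ℝ) *
        ((∏ i, (f (σ (l i))).eval (q * y i) * (f (σ (r i))).eval (y i)) *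
          ∏ k ∈ rest, v k (σ k)) := by
      -- Transposing makes `σ` act on columns, that is on the polynomials, while each row keeps its
      -- node.
      rw [← Matrix.det_transpose, Matrix.det_apply']
      refine Finset.sum_congr rfl fun σ _ => ?_
      rw [hprod]
      simp only [Matrix.transpose_apply, hMl, hMr]
      rw [Finset.prod_congr rfl fun k hk => hMv y k hk (σ k)]
    rw [hdet, ← mul_assoc, ← h, Finset.sum_mul]
    refine Finset.sum_congr rfl fun σ _ => ?_
    simp only [qSkewKernel, Finset.prod_mul_distrib]
    rw [Finset.prod_congr rfl fun i _ => by
      rw [mul_comm (eval (q * y i) (f (σ (r i)))) (eval (y i) (f (σ (l i))))]]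
    ring
  rw [← jacksonIntegralPi_const_mul]
  simp_rw [hint]
  rw [jacksonIntegralPi_sum_prod Finset.univ n _
    (fun (σ : Perm ι) i => qSkewKernel q ω (f (σ (l i))) (f (σ (r i))))
    fun σ _ i => jacksonIntegrable_qSkewKernel hq hω _ _]
  refine Finset.sum_congr rfl fun σ _ => ?_
  simp only [qSkewInner_eq_integral_kernel]
  ring

/-! ### The paired nodes and their Vandermonde determinant -/

/-- The even positions in `Fin (2 * n)`. -/
def evenPos {n : ℕ} (i : Fin n) : Fin (2 * n) := ⟨2 * i, by omega⟩

/-- The odd positions in `Fin (2 * n)`. -/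
def oddPos {n : ℕ} (i : Fin n) : Fin (2 * n) := ⟨2 * i + 1, by omega⟩

theorem evenPos_ne_oddPos {n : ℕ} (i j : Fin n) : evenPos i ≠ oddPos j := by
  simp only [evenPos, oddPos, ne_eq, Fin.mk.injEq]
  omega

theorem evenPos_injective {n : ℕ} : Function.Injective (evenPos (n := n)) := by
  intro i j h
  simp only [evenPos, Fin.mk.injEq] at h
  omega

theorem oddPos_injective {n : ℕ} : Function.Injective (oddPos (n := n)) := by
  intro i j h
  simp only [oddPos, Fin.mk.injEq] at h
  omega

theorem eq_evenPos_or_oddPos {n : ℕ} (k : Fin (2 * n)) : ∃ i, k = evenPos i ∨ k = oddPos i := by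
  refine ⟨⟨k / 2, by omega⟩, ?_⟩
  simp only [evenPos, oddPos, Fin.ext_iff]
  omega

theorem prod_evenPos_mul_oddPos {n : ℕ} (F : Fin (2 * n) → ℝ) :
    ∏ k, F k = ∏ i, F (evenPos i) * F (oddPos i) := by
  induction n with
  | zero => simp
  | succ n ih =>
    have h := ih fun k => F (Fin.succ (Fin.succ k))
    rw [Fin.prod_univ_succ (n := n), ← mul_one (F (evenPos 0) * _)]
    refine (Fin.prod_univ_succ (n := 2 * n + 1) F).trans ?_
    rw [Fin.prod_univ_succ, h, ← mul_assoc, mul_one]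
    rfl

/-- The nodes `q y_0, y_0, q y_1, y_1, …`. -/
def qNodes (q : ℝ) {n : ℕ} (y : Fin n → ℝ) (k : Fin (2 * n)) : ℝ :=
  if (k : ℕ) % 2 = 0 then q * y ⟨k / 2, by omega⟩ else y ⟨k / 2, by omega⟩

theorem qNodes_evenPos (q : ℝ) {n : ℕ} (y : Fin n → ℝ) (i : Fin n) :
    qNodes q y (evenPos i) = q * y i := by
  simp [qNodes, evenPos]

theorem qNodes_oddPos (q : ℝ) {n : ℕ} (y : Fin n → ℝ) (i : Fin n) :
    qNodes q y (oddPos i) = y i := by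
  have h : (2 * (i : ℕ) + 1) / 2 = i := by omega
  simp [qNodes, oddPos, h, Nat.add_mod]

theorem qNodes_succ_succ (q : ℝ) {n : ℕ} (y : Fin (n + 1) → ℝ) (k : Fin (2 * n)) :
    qNodes q y (Fin.succ (Fin.succ k) : Fin (2 * n + 2)) =
      qNodes q (fun i => y i.succ) k := by
  obtain ⟨i, rfl | rfl⟩ := eq_evenPos_or_oddPos k
  · exact (qNodes_evenPos q y i.succ).trans (qNodes_evenPos q (fun i => y i.succ) i).symm
  · exact (qNodes_oddPos q y i.succ).trans (qNodes_oddPos q (fun i => y i.succ) i).symm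

theorem det_vandermonde_succ {m : ℕ} (v : Fin (m + 1) → ℝ) :
    (Matrix.vandermonde v).det =
      (∏ j : Fin m, (v j.succ - v 0)) * (Matrix.vandermonde fun j : Fin m => v j.succ).det := by
  rw [Matrix.det_vandermonde, Matrix.det_vandermonde, Fin.prod_univ_succ, Fin.prod_Ioi_zero]
  congr 1
  refine Finset.prod_congr rfl fun i _ => ?_
  rw [Fin.prod_Ioi_succ]

theorem qDelta4_succ (q : ℝ) {n : ℕ} (y : Fin (n + 1) → ℝ) :
    qDelta4 q y = (∏ k : Fin n, ((y 0 - y k.succ) ^ 2 * (y 0 - q * y k.succ) *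
      (y 0 - q⁻¹ * y k.succ))) * qDelta4 q fun i => y i.succ := by
  rw [qDelta4, Fin.prod_univ_succ, Fin.prod_Ioi_zero, qDelta4]
  congr 1
  refine Finset.prod_congr rfl fun i _ => ?_
  rw [Fin.prod_Ioi_succ]

/-- Peel off the two nodes `q y_0, y_0`. Their difference is `(1-q) y_0`, and their four differences
with a later pair multiply to `q^2` times a factor of `Δ_q^4`. There are `n(n-1)/2` pairs of pairs.
-/
theorem det_vandermonde_qNodes {q : ℝ} (hq : q ≠ 0) {n : ℕ} (y : Fin n → ℝ) :
    (Matrix.vandermonde (qNodes q y)).det =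
      q ^ (n * (n - 1)) * qDelta4 q y * ∏ i, ((1 - q) * y i) := by
  induction n with
  | zero => simp [qDelta4]
  | succ n ih =>
    have h0 : qNodes q y (0 : Fin (2 * n + 2)) = q * y 0 := qNodes_evenPos q y 0
    have h1 : qNodes q y (Fin.succ 0 : Fin (2 * n + 2)) = y 0 := qNodes_oddPos q y 0
    refine (det_vandermonde_succ (m := 2 * n + 1) (qNodes q y)).trans ?_
    rw [Fin.prod_univ_succ, det_vandermonde_succ]
    simp only [qNodes_succ_succ, h0, h1]
    rw [ih, qDelta4_succ, prod_evenPos_mul_oddPos, prod_evenPos_mul_oddPos, Fin.prod_univ_succ]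
    simp only [qNodes_evenPos, qNodes_oddPos]
    have hpow : q ^ ((n + 1) * (n + 1 - 1)) = q ^ (n * (n - 1)) * ∏ _i : Fin n, q ^ 2 := by
      rw [Finset.prod_const, Finset.card_univ, Fintype.card_fin, ← pow_mul, ← pow_add]
      congr 1
      cases n with
      | zero => rfl
      | succ n => simp only [Nat.add_sub_cancel]; ring
    have hfac : (∏ i : Fin n, (q * y i.succ - q * y 0) * (y i.succ - q * y 0)) *
        (∏ i : Fin n, (q * y i.succ - y 0) * (y i.succ - y 0)) =
        (∏ _i : Fin n, q ^ 2) * ∏ k : Fin n, ((y 0 - y k.succ) ^ 2 * (y 0 - q * y k.succ) *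
      (y 0 - q⁻¹ * y k.succ)) := by
      rw [← Finset.prod_mul_distrib, ← Finset.prod_mul_distrib]
      refine Finset.prod_congr rfl fun i _ => ?_
      field_simp
      ring
    rw [hpow]
    linear_combination ((y 0 - q * y 0) * (q ^ (n * (n - 1)) * qDelta4 q (fun i => y i.succ) *
      ∏ i : Fin n, (1 - q) * y i.succ)) * hfac

/-! ### Bordered Vandermonde determinants -/

/-- Monomials `1, X, …, X^(m-1)` together with one more polynomial `g`. -/
noncomputable def monomialsAnd (m : ℕ) (g : ℝ[X]) : Fin m ⊕ Unit → ℝ[X] :=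
  Sum.elim (fun k => X ^ (k : ℕ)) fun _ => g

/-- The matrix of values of `monomialsAnd m g` at the nodes `N`, with an extra row `v`. -/
noncomputable def borderedVandermonde {m : ℕ} (N : Fin m → ℝ) (g : ℝ[X])
    (v : Fin m ⊕ Unit → ℝ) : Matrix (Fin m ⊕ Unit) (Fin m ⊕ Unit) ℝ :=
  Matrix.of (Sum.elim (fun k j => (monomialsAnd m g j).eval (N k)) fun _ => v)

theorem det_borderedVandermonde_single {m : ℕ} (N : Fin m → ℝ) (g : ℝ[X]) :
    (borderedVandermonde N g (Pi.single (Sum.inr ()) 1)).det = (Matrix.vandermonde N).det := by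
  have h : borderedVandermonde N g (Pi.single (Sum.inr ()) 1) =
      Matrix.fromBlocks (Matrix.vandermonde N) (Matrix.of fun k _ => g.eval (N k)) 0 1 := by
    ext i j
    rcases i with i | i <;> rcases j with j | j <;>
      simp [borderedVandermonde, monomialsAnd, Matrix.vandermonde_apply]
  rw [h, Matrix.det_fromBlocks_zero₂₁, Matrix.det_one, mul_one]

/-- Adding multiples of the monomial columns to the last one replaces `g` by `G`, which vanishes at
the nodes, so only the corner entry `G(x)` survives there. -/
theorem det_borderedVandermonde_eval {m : ℕ} (N : Fin m → ℝ) {g G : ℝ[X]}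
    (hG : (G - g).degree < m) (hN : ∀ k, G.eval (N k) = 0) (x : ℝ) :
    (borderedVandermonde N g fun j => (monomialsAnd m g j).eval x).det =
      (Matrix.vandermonde N).det * G.eval x := by
  set A := borderedVandermonde N g fun j => (monomialsAnd m g j).eval x with hA
  have hev : ∀ t : ℝ, g.eval t + ∑ j : Fin m, (G - g).coeff j * t ^ (j : ℕ) = G.eval t := by
    intro t
    have h : (G - g).eval t = ∑ j : Fin m, (G - g).coeff j * t ^ (j : ℕ) := by
      rw [Fin.sum_univ_eq_sum_range (fun j => (G - g).coeff j * t ^ j)]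
      by_cases h0 : G - g = 0
      · simp [h0]
      · exact eval_eq_sum_range' ((natDegree_lt_iff_degree_lt h0).mpr hG) t
    rw [← h]
    simp
  have hdet := Matrix.det_updateCol_sum A (Sum.inr ())
    (Sum.elim (fun j : Fin m => (G - g).coeff j) fun _ => 1)
  have hblock : (A.updateCol (Sum.inr ()) fun k =>
      ∑ i, (Sum.elim (fun j : Fin m => (G - g).coeff j) (fun _ => (1 : ℝ)) i) • A k i) =
      Matrix.fromBlocks (Matrix.vandermonde N) 0 (Matrix.of fun _ j => x ^ (j : ℕ))
        (Matrix.of fun _ _ => G.eval x) := by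
    ext i j
    rcases j with j | j
    · rcases i with i | i <;>
        simp [hA, borderedVandermonde, monomialsAnd, Matrix.vandermonde_apply]
    · rcases i with i | i
      · simp [hA, borderedVandermonde, monomialsAnd]
        rw [add_comm, ← hN i, ← hev]
        simp
      · simp [hA, borderedVandermonde, monomialsAnd]
        rw [add_comm, ← hev x]
        simp
  rw [hblock, Matrix.det_fromBlocks_zero₁₂] at hdet
  simpa using hdet.symm

theorem degree_prod_sub_X_pow_lt {m : ℕ} (N : Fin m → ℝ) :
    ((∏ k, (X - C (N k))) - X ^ m : ℝ[X]).degree < m := by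
  have hm : (∏ k, (X - C (N k)) : ℝ[X]).Monic := monic_prod_of_monic _ _ fun k _ => monic_X_sub_C _
  have hd : (∏ k, (X - C (N k)) : ℝ[X]).degree = m := by
    simp [degree_prod]
  rw [← hd]
  refine degree_sub_lt_left ?_ hm.ne_zero ?_
  · rw [hd, degree_X_pow]
  · rw [hm.leadingCoeff, (monic_X_pow m).leadingCoeff]

/-- The product has subleading coefficient `-∑ N_k`, which the linear factor compensates. This is
the origin of `(1+q) ∑ y_i` in the odd formula. -/
theorem degree_linear_mul_prod_sub_lt {m : ℕ} (N : Fin m → ℝ) (c : ℝ) :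
    ((X + C (∑ k, N k) + C c) * (∏ k, (X - C (N k))) - (X ^ (m + 1) + C c * X ^ m) :
      ℝ[X]).degree < m := by
  have hm : (∏ k, (X - C (N k)) : ℝ[X]).Monic := monic_prod_of_monic _ _ fun k _ => monic_X_sub_C _
  have hd : (∏ k, (X - C (N k)) : ℝ[X]).natDegree = m := by
    simp [natDegree_prod_of_monic _ _ fun k _ => monic_X_sub_C (N k)]
  have hnext := prod_X_sub_C_nextCoeff (s := Finset.univ) N
  set p := (∏ k, (X - C (N k)) : ℝ[X]) with hp
  have hlead : p.coeff m = 1 := by rw [← hd]; exact hm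
  have hhigh : ∀ k, m < k → p.coeff k = 0 := fun k hk =>
    coeff_eq_zero_of_natDegree_lt (by rwa [hd])
  rw [nextCoeff, hd] at hnext
  rw [degree_lt_iff_coeff_zero]
  intro k hk
  cases k with
  | zero =>
    obtain rfl : m = 0 := by omega
    simp [hp]
  | succ k =>
    simp only [add_mul, coeff_sub, coeff_add, coeff_X_mul, coeff_C_mul, coeff_X_pow]
    rcases lt_trichotomy (k + 1) m with h | h | h
    · omega
    · subst h
      simp only [Nat.add_eq_zero_iff, one_ne_zero, and_false, if_false, Nat.add_sub_cancel]
        at hnext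
      rw [hnext, hlead]
      simp
    · rw [hhigh _ h]
      rcases eq_or_ne k m with rfl | hkm
      · simp [hlead]
      · rw [hhigh k (by omega)]
        simp [hkm]
        omega

/-! ### The moment Pfaffian and nondegeneracy -/

theorem sum_pfaffian_prod_eq {q : ℝ} (hq : q ≠ 0) {a b : EReal} {ω : ℝ → ℝ}
    (hω : HasJacksonMoments q a b ω) {n : ℕ} (f : Fin (2 * n) → ℝ[X]) :
    ∑ σ : Perm (Fin (2 * n)), ((Perm.sign σ : ℤ) : ℝ) *
      ∏ i, qSkewInner q a b ω (f (σ (evenPos i))) (f (σ (oddPos i))) =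
    2 ^ n * jacksonIntegralPi q a b n fun y =>
      (Matrix.of fun k j => (f j).eval (qNodes q y k)).det *
        ∏ i, (ω (y i) / ((1 - q) * y i)) := by
  have h := sum_sign_mul_prod_qSkewInner hq hω evenPos oddPos (fun i => evenPos_ne_oddPos i i)
    (fun i j hij => ⟨evenPos_injective.ne hij, evenPos_ne_oddPos i j,
      (evenPos_ne_oddPos j i).symm, oddPos_injective.ne hij⟩) ∅ (by simp)
    (fun F => by simpa using prod_evenPos_mul_oddPos F) f (fun _ _ => 0)
    (fun y => Matrix.of fun k j => (f j).eval (qNodes q y k))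
    (fun y i j => by simp [qNodes_evenPos]) (fun y i j => by simp [qNodes_oddPos]) (by simp)
  simpa using h

/-- Away from the coordinate hyperplanes, the factors `(1-q) y_i` of the Vandermonde determinant
cancel the denominators of the kernels. -/
theorem jacksonIntegralPi_vandermonde_mul {q : ℝ} (hq0 : q ≠ 0) (hq1 : q ≠ 1) (a b : EReal)
    (ω : ℝ → ℝ) {n : ℕ} (F : (Fin n → ℝ) → ℝ) :
    (jacksonIntegralPi q a b n fun y => (Matrix.vandermonde (qNodes q y)).det * F y *
      ∏ i, (ω (y i) / ((1 - q) * y i))) =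
    q ^ (n * (n - 1)) * jacksonIntegralPi q a b n fun y => qDelta4 q y * F y * ∏ i, ω (y i) := by
  rw [← jacksonIntegralPi_const_mul]
  refine jacksonIntegralPi_congr_of_ne_zero hq0 a b fun y hy => ?_
  have hne : ∏ i, ((1 - q) * y i) ≠ 0 :=
    Finset.prod_ne_zero_iff.mpr fun i _ => mul_ne_zero (sub_ne_zero.mpr hq1.symm) (hy i)
  rw [det_vandermonde_qNodes hq0, Finset.prod_div_distrib]
  field_simp

theorem jacksonIntegralPi_vandermonde {q : ℝ} (hq0 : q ≠ 0) (hq1 : q ≠ 1) (a b : EReal)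
    (ω : ℝ → ℝ) (n : ℕ) :
    (jacksonIntegralPi q a b n fun y => (Matrix.vandermonde (qNodes q y)).det *
      ∏ i, (ω (y i) / ((1 - q) * y i))) =
    q ^ (n * (n - 1)) * (n.factorial * qTau q a b ω n) := by
  have h := jacksonIntegralPi_vandermonde_mul hq0 hq1 a b ω (n := n) fun _ => 1
  simp only [mul_one] at h
  rw [h, qTau, one_div, mul_inv_cancel_left₀ (Nat.cast_ne_zero.mpr n.factorial_ne_zero)]

theorem pfaffian_qMomentMatrix {q : ℝ} (hq0 : q ≠ 0) (hq1 : q ≠ 1) {a b : EReal} {ω : ℝ → ℝ}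
    (hω : HasJacksonMoments q a b ω) (n : ℕ) :
    pfaffian (qMomentMatrix q a b ω n) = q ^ (n * (n - 1)) * qTau q a b ω n := by
  have h := sum_pfaffian_prod_eq hq0 hω (n := n) fun k => X ^ (k : ℕ)
  simp only [eval_pow, eval_X] at h
  have h' := h.trans (congrArg (2 ^ n * ·) (jacksonIntegralPi_vandermonde hq0 hq1 a b ω n))
  unfold pfaffian
  refine (congrArg (1 / (2 ^ n * (n.factorial : ℝ)) * ·) h').trans ?_
  have : (n.factorial : ℝ) ≠ 0 := Nat.cast_ne_zero.mpr n.factorial_ne_zero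
  field_simp

/-- The skew inner product is nondegenerate on polynomials of degree less than `2n`. -/
theorem eq_zero_of_qSkewInner_X_pow_eq_zero {q : ℝ} (hq0 : q ≠ 0) (hq1 : q ≠ 1) {a b : EReal}
    {ω : ℝ → ℝ} (hω : HasJacksonMoments q a b ω) {n : ℕ} (hτ : qTau q a b ω n ≠ 0) {p : ℝ[X]}
    (hp : p.degree < (2 * n : ℕ)) (h : ∀ k < 2 * n, qSkewInner q a b ω p (X ^ k) = 0) :
    p = 0 := by
  have hcoeff : ∀ r : Fin (2 * n), p.coeff r = 0 := by
    intro r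
    -- Put `p` in place of `X^r`. Every product in the Pfaffian sum then contains a pairing of `p`
    -- with a monomial, so the sum is 0; by column operations the integral is `p.coeff r` times a
    -- nonzero multiple of `τ_{2n}`.
    set f : Fin (2 * n) → ℝ[X] := Function.update (fun k => X ^ (k : ℕ)) r p with hf
    have hsum := sum_pfaffian_prod_eq hq0 hω f
    have hdet : ∀ y : Fin n → ℝ, (Matrix.of fun k j => (f j).eval (qNodes q y k)).det =
        p.coeff r * (Matrix.vandermonde (qNodes q y)).det := by
      intro y
      refine Eq.trans ?_ (Matrix.det_updateCol_sum (Matrix.vandermonde (qNodes q y)) r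
        fun k => p.coeff k)
      congr 1
      ext k j
      by_cases hj : j = r
      · subst hj
        rw [Matrix.updateCol_self, Matrix.of_apply, hf, Function.update_self]
        simp only [Matrix.vandermonde_apply, smul_eq_mul]
        rw [Fin.sum_univ_eq_sum_range (fun j => p.coeff j * qNodes q y k ^ j)]
        by_cases h0 : p = 0
        · simp [h0]
        · exact eval_eq_sum_range' ((natDegree_lt_iff_degree_lt h0).mpr hp) _
      · rw [Matrix.updateCol_ne hj, Matrix.of_apply, hf, Function.update_of_ne hj]
        simp [Matrix.vandermonde_apply]
    simp_rw [hdet, mul_assoc] at hsum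
    rw [jacksonIntegralPi_const_mul, jacksonIntegralPi_vandermonde hq0 hq1,
      Finset.sum_eq_zero] at hsum
    · have hfac : (n.factorial : ℝ) ≠ 0 := Nat.cast_ne_zero.mpr n.factorial_ne_zero
      have h2 : (2 : ℝ) ^ n ≠ 0 := by positivity
      simpa [h2, hfac, hτ, hq0, pow_ne_zero] using hsum.symm
    · intro σ _
      obtain ⟨i, hi⟩ := eq_evenPos_or_oddPos (σ.symm r)
      have hzero : qSkewInner q a b ω (f (σ (evenPos i))) (f (σ (oddPos i))) = 0 := by
        rcases hi with hi | hi
        · have h1 : σ (evenPos i) = r := by rw [← hi, Equiv.apply_symm_apply]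
          have h2 : σ (oddPos i) ≠ r := fun e =>
            evenPos_ne_oddPos i i (σ.injective (h1.trans e.symm))
          rw [h1, hf, Function.update_self, Function.update_of_ne h2]
          exact h _ (σ (oddPos i)).isLt
        · have h1 : σ (oddPos i) = r := by rw [← hi, Equiv.apply_symm_apply]
          have h2 : σ (evenPos i) ≠ r := fun e =>
            evenPos_ne_oddPos i i (σ.injective (e.trans h1.symm))
          rw [h1, hf, Function.update_self, Function.update_of_ne h2, qSkewInner_swap,
            h _ (σ (evenPos i)).isLt, neg_zero]
      rw [Finset.prod_eq_zero (Finset.mem_univ i) hzero, mul_zero]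
  ext k
  by_cases hk : k < 2 * n
  · exact hcoeff ⟨k, hk⟩
  · exact (degree_lt_iff_coeff_zero _ _).mp hp k (not_lt.mp hk)

/-! ### Skew orthogonal polynomials from odd-size Pfaffians -/

/-- The signed weight of a permutation in the expansion of an odd-size Pfaffian. -/
noncomputable def qPfWeight (q : ℝ) (a b : EReal) (ω : ℝ → ℝ) (n : ℕ) (g : ℝ[X])
    (σ : Perm (Fin (2 * n) ⊕ Unit)) : ℝ :=
  ((Perm.sign σ : ℤ) : ℝ) * ∏ i, qSkewInner q a b ω
    (monomialsAnd (2 * n) g (σ (Sum.inl (evenPos i))))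
    (monomialsAnd (2 * n) g (σ (Sum.inl (oddPos i))))

/-- The Pfaffian expansion polynomial attached to `1, X, …, X^(2n-1), g`. -/
noncomputable def qPfPoly (q : ℝ) (a b : EReal) (ω : ℝ → ℝ) (n : ℕ) (g : ℝ[X]) : ℝ[X] :=
  ∑ σ : Perm (Fin (2 * n) ⊕ Unit),
    qPfWeight q a b ω n g σ • monomialsAnd (2 * n) g (σ (Sum.inr ()))

/-- De Bruijn's formula with the last index unpaired. The row `v` stands for a functional on the
expansion: values at `x` give evaluation, a unit vector gives the total weight of `g`. -/
theorem sum_qPfWeight_mul {q : ℝ} (hq : q ≠ 0) {a b : EReal} {ω : ℝ → ℝ}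
    (hω : HasJacksonMoments q a b ω) (n : ℕ) (g : ℝ[X]) (v : Fin (2 * n) ⊕ Unit → ℝ) :
    ∑ σ : Perm (Fin (2 * n) ⊕ Unit), qPfWeight q a b ω n g σ * v (σ (Sum.inr ())) =
    2 ^ n * jacksonIntegralPi q a b n fun y =>
      (borderedVandermonde (qNodes q y) g v).det * ∏ i, (ω (y i) / ((1 - q) * y i)) := by
  have h := sum_sign_mul_prod_qSkewInner hq hω
    (fun i : Fin n => (Sum.inl (evenPos i) : Fin (2 * n) ⊕ Unit)) (fun i => Sum.inl (oddPos i))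
    (fun i => Sum.inl_injective.ne (evenPos_ne_oddPos i i))
    (fun i j hij => ⟨Sum.inl_injective.ne (evenPos_injective.ne hij),
      Sum.inl_injective.ne (evenPos_ne_oddPos i j),
      Sum.inl_injective.ne (evenPos_ne_oddPos j i).symm,
      Sum.inl_injective.ne (oddPos_injective.ne hij)⟩) {Sum.inr ()} (by simp)
    (fun F => by simp [Fintype.prod_sum_type, prod_evenPos_mul_oddPos])
    (monomialsAnd (2 * n) g) (fun _ j => v j)
    (fun y => borderedVandermonde (qNodes q y) g v)
    (fun y i j => by simp [borderedVandermonde, qNodes_evenPos])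
    (fun y i j => by simp [borderedVandermonde, qNodes_oddPos])
    (fun y k hk j => by
      rw [Finset.mem_singleton.mp hk]
      simp [borderedVandermonde])
  simpa [qPfWeight, mul_assoc] using h

theorem eval_qPfPoly {q : ℝ} (hq0 : q ≠ 0) (hq1 : q ≠ 1) {a b : EReal} {ω : ℝ → ℝ}
    (hω : HasJacksonMoments q a b ω) (n : ℕ) (g : ℝ[X]) (G : (Fin n → ℝ) → ℝ[X])
    (hG : ∀ y, (G y - g).degree < (2 * n : ℕ)) (hN : ∀ y k, (G y).eval (qNodes q y k) = 0)
    (x : ℝ) :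
    (qPfPoly q a b ω n g).eval x = 2 ^ n * q ^ (n * (n - 1)) *
      jacksonIntegralPi q a b n fun y => qDelta4 q y * (G y).eval x * ∏ i, ω (y i) := by
  have h := sum_qPfWeight_mul hq0 hω n g fun j => (monomialsAnd (2 * n) g j).eval x
  simp_rw [fun y => det_borderedVandermonde_eval (qNodes q y) (hG y) (hN y) x] at h
  rw [jacksonIntegralPi_vandermonde_mul hq0 hq1 a b ω fun y => (G y).eval x, ← mul_assoc] at h
  rw [← h, qPfPoly, eval_finsetSum]
  simp

theorem degree_qPfPoly_sub_lt {q : ℝ} (hq0 : q ≠ 0) (hq1 : q ≠ 1) {a b : EReal} {ω : ℝ → ℝ}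
    (hω : HasJacksonMoments q a b ω) (n : ℕ) (g : ℝ[X]) :
    (qPfPoly q a b ω n g -
      (2 ^ n * (q ^ (n * (n - 1)) * (n.factorial * qTau q a b ω n))) • g).degree < (2 * n : ℕ) := by
  have h := sum_qPfWeight_mul hq0 hω n g (Pi.single (Sum.inr ()) 1)
  simp_rw [det_borderedVandermonde_single] at h
  rw [jacksonIntegralPi_vandermonde hq0 hq1] at h
  -- The constant is the total weight of the permutations with `g` last, so subtracting term by term
  -- leaves only monomials of degree `< 2n`.
  rw [← h, qPfPoly, Finset.sum_smul, ← Finset.sum_sub_distrib, ← mem_degreeLT]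
  refine Submodule.sum_mem _ fun σ _ => ?_
  rw [mul_smul, ← smul_sub]
  refine Submodule.smul_mem _ _ ?_
  rw [mem_degreeLT]
  rcases σ (Sum.inr ()) with k | k
  · simp [monomialsAnd, -Nat.cast_mul]
  · simp [monomialsAnd, -Nat.cast_mul]

theorem qSkewInner_qPfPoly_X_pow {q : ℝ} (hq : q ≠ 0) {a b : EReal} {ω : ℝ → ℝ}
    (hω : HasJacksonMoments q a b ω) (n : ℕ) (g : ℝ[X]) {k : ℕ} (hk : k < 2 * n) :
    qSkewInner q a b ω (qPfPoly q a b ω n g) (X ^ k) = 0 := by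
  have h := sum_sign_mul_prod_mul_eq_zero
    (fun i : Fin n => (Sum.inl (evenPos i) : Fin (2 * n) ⊕ Unit)) (fun i => Sum.inl (oddPos i))
    (Sum.inr ()) (fun i => Sum.inl_injective.ne (evenPos_ne_oddPos i i))
    (fun i j hij => ⟨Sum.inl_injective.ne (evenPos_injective.ne hij),
      Sum.inl_injective.ne (evenPos_ne_oddPos i j),
      Sum.inl_injective.ne (evenPos_ne_oddPos j i).symm,
      Sum.inl_injective.ne (oddPos_injective.ne hij)⟩) (by simp) (by simp)
    (by
      rintro (k | k)
      · obtain ⟨i, hi⟩ := eq_evenPos_or_oddPos k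
        exact Or.inr ⟨i, by simpa using hi⟩
      · exact Or.inl rfl)
    (fun i j => qSkewInner q a b ω (monomialsAnd (2 * n) g i) (monomialsAnd (2 * n) g j))
    (fun i j => qSkewInner_swap _ _ _ _ _ _) (Sum.inl ⟨k, hk⟩)
  rw [← qSkewForm_apply hq hω, qPfPoly, map_sum, LinearMap.sum_apply]
  simpa [qSkewForm_apply, qPfWeight, mul_assoc, monomialsAnd] using h

/-- The polynomial `g + (degree < 2n)` that is skew orthogonal to `1, X, …, X^(2n-1)`. -/
noncomputable def qSkewPoly (q : ℝ) (a b : EReal) (ω : ℝ → ℝ) (n : ℕ) (g : ℝ[X]) : ℝ[X] :=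
  (2 ^ n * (q ^ (n * (n - 1)) * (n.factorial * qTau q a b ω n)))⁻¹ • qPfPoly q a b ω n g

theorem degree_qSkewPoly_sub_lt {q : ℝ} (hq0 : q ≠ 0) (hq1 : q ≠ 1) {a b : EReal} {ω : ℝ → ℝ}
    (hω : HasJacksonMoments q a b ω) {n : ℕ} (hτ : qTau q a b ω n ≠ 0) (g : ℝ[X]) :
    (qSkewPoly q a b ω n g - g).degree < (2 * n : ℕ) := by
  have hc : (2 ^ n * (q ^ (n * (n - 1)) * (n.factorial * qTau q a b ω n))) ≠ 0 := by
    have hfac : (n.factorial : ℝ) ≠ 0 := Nat.cast_ne_zero.mpr n.factorial_ne_zero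
    have h2 : (2 : ℝ) ^ n ≠ 0 := by positivity
    exact mul_ne_zero h2 (mul_ne_zero (pow_ne_zero _ hq0) (mul_ne_zero hfac hτ))
  have h := degree_qPfPoly_sub_lt hq0 hq1 hω n g
  rw [← mem_degreeLT] at h ⊢
  have h' := Submodule.smul_mem _
    (2 ^ n * (q ^ (n * (n - 1)) * (n.factorial * qTau q a b ω n)))⁻¹ h
  rwa [smul_sub, smul_smul, inv_mul_cancel₀ hc, one_smul] at h'

theorem qSkewInner_qSkewPoly_X_pow {q : ℝ} (hq0 : q ≠ 0) {a b : EReal} {ω : ℝ → ℝ}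
    (hω : HasJacksonMoments q a b ω) {n : ℕ} (g : ℝ[X]) {k : ℕ} (hk : k < 2 * n) :
    qSkewInner q a b ω (qSkewPoly q a b ω n g) (X ^ k) = 0 := by
  rw [← qSkewForm_apply hq0 hω, qSkewPoly, map_smul, LinearMap.smul_apply, qSkewForm_apply,
    qSkewInner_qPfPoly_X_pow hq0 hω n g hk, smul_zero]

/-- If `τ_{2n} = 0`, both sides are 0, the inverse of 0 being 0. -/
theorem eval_qSkewPoly {q : ℝ} (hq0 : q ≠ 0) (hq1 : q ≠ 1) {a b : EReal} {ω : ℝ → ℝ}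
    (hω : HasJacksonMoments q a b ω) {n : ℕ} (g : ℝ[X]) (G : (Fin n → ℝ) → ℝ[X])
    (hG : ∀ y, (G y - g).degree < (2 * n : ℕ)) (hN : ∀ y k, (G y).eval (qNodes q y k) = 0)
    (x : ℝ) :
    (qSkewPoly q a b ω n g).eval x = 1 / ((n.factorial : ℝ) * qTau q a b ω n) *
      jacksonIntegralPi q a b n fun y => qDelta4 q y * (G y).eval x * ∏ i, ω (y i) := by
  have hfac : (n.factorial : ℝ) ≠ 0 := Nat.cast_ne_zero.mpr n.factorial_ne_zero
  rw [qSkewPoly, eval_smul, eval_qPfPoly hq0 hq1 hω n g G hG hN, smul_eq_mul]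
  field_simp

theorem eval_prod_X_sub_C_qNodes {q : ℝ} {n : ℕ} (y : Fin n → ℝ) (x : ℝ) :
    (∏ k, (X - C (qNodes q y k))).eval x = ∏ i, ((x - y i) * (x - q * y i)) := by
  rw [eval_prod, prod_evenPos_mul_oddPos]
  refine Finset.prod_congr rfl fun i _ => ?_
  simp only [qNodes_evenPos, qNodes_oddPos, eval_sub, eval_X, eval_C]
  ring

theorem eval_prod_X_sub_C_qNodes_self {q : ℝ} {n : ℕ} (y : Fin n → ℝ) (k : Fin (2 * n)) :
    (∏ k, (X - C (qNodes q y k))).eval (qNodes q y k) = 0 := by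
  rw [eval_prod]
  exact Finset.prod_eq_zero (Finset.mem_univ k) (by simp)

theorem sum_qNodes {q : ℝ} {n : ℕ} (y : Fin n → ℝ) : ∑ k, qNodes q y k = (1 + q) * ∑ i, y i := by
  induction n with
  | zero => simp
  | succ n ih =>
    have h0 : qNodes q y (0 : Fin (2 * n + 2)) = q * y 0 := qNodes_evenPos q y 0
    have h1 : qNodes q y (Fin.succ 0 : Fin (2 * n + 2)) = y 0 := qNodes_oddPos q y 0
    refine (Fin.sum_univ_succ (n := 2 * n + 1) (qNodes q y)).trans ?_
    rw [Fin.sum_univ_succ, Fin.sum_univ_succ (n := n)]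
    simp only [qNodes_succ_succ, h0, h1]
    rw [ih]
    ring

theorem eval_qSkewPoly_even {q : ℝ} (hq0 : q ≠ 0) (hq1 : q ≠ 1) {a b : EReal} {ω : ℝ → ℝ}
    (hω : HasJacksonMoments q a b ω) {n : ℕ} (x : ℝ) :
    (qSkewPoly q a b ω n (X ^ (2 * n))).eval x = 1 / ((n.factorial : ℝ) * qTau q a b ω n) *
      jacksonIntegralPi q a b n fun y =>
        qDelta4 q y * ∏ i, ((x - y i) * (x - q * y i) * ω (y i)) := by
  rw [eval_qSkewPoly hq0 hq1 hω _ (fun y => ∏ k, (X - C (qNodes q y k)))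
    (fun y => degree_prod_sub_X_pow_lt _) eval_prod_X_sub_C_qNodes_self]
  simp_rw [eval_prod_X_sub_C_qNodes, mul_assoc, ← Finset.prod_mul_distrib, mul_assoc]

theorem eval_qSkewPoly_odd {q : ℝ} (hq0 : q ≠ 0) (hq1 : q ≠ 1) {a b : EReal} {ω : ℝ → ℝ}
    (hω : HasJacksonMoments q a b ω) {n : ℕ} (c x : ℝ) :
    (qSkewPoly q a b ω n (X ^ (2 * n + 1) + C c * X ^ (2 * n))).eval x =
      1 / ((n.factorial : ℝ) * qTau q a b ω n) *
      jacksonIntegralPi q a b n fun y =>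
        qDelta4 q y * (x + (1 + q) * (∑ i, y i) + c) *
          ∏ i, ((x - y i) * (x - q * y i) * ω (y i)) := by
  rw [eval_qSkewPoly hq0 hq1 hω _
    (fun y => (X + C (∑ k, qNodes q y k) + C c) * ∏ k, (X - C (qNodes q y k)))
    (fun y => degree_linear_mul_prod_sub_lt _ c)
    (fun y k => by rw [eval_mul, eval_prod_X_sub_C_qNodes_self, mul_zero])]
  simp_rw [eval_mul, eval_prod_X_sub_C_qNodes, sum_qNodes, eval_add, eval_X, eval_C, mul_assoc,
    ← Finset.prod_mul_distrib, mul_assoc]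

/-! ### Characterization and uniqueness of skew orthogonal sequences -/

/-- Monic polynomials of degrees `0, …, m-1` span degree `< m`, by eliminating the top coefficient.
Serves to pass between the `Q_k` and the monomials in both directions. -/
theorem qSkewInner_eq_zero_of_degree_lt {q : ℝ} (hq0 : q ≠ 0) {a b : EReal} {ω : ℝ → ℝ}
    (hω : HasJacksonMoments q a b ω) {p : ℝ[X]} {m : ℕ} {Q : ℕ → ℝ[X]}
    (hQ : ∀ k < m, (Q k).Monic ∧ (Q k).natDegree = k)
    (h : ∀ k < m, qSkewInner q a b ω p (Q k) = 0) {r : ℝ[X]} (hr : r.degree < m) :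
    qSkewInner q a b ω p r = 0 := by
  induction m generalizing r with
  | zero =>
    rw [Nat.cast_zero, Nat.WithBot.lt_zero_iff, degree_eq_bot] at hr
    rw [hr, ← qSkewForm_apply hq0 hω, map_zero]
  | succ m ih =>
    have hdeg : (r - r.coeff m • Q m).degree < m := by
      rw [degree_lt_iff_coeff_zero] at hr ⊢
      intro k hk
      obtain ⟨hmon, hnat⟩ := hQ m m.lt_succ_self
      rcases hk.eq_or_lt with rfl | hk
      · have : (Q m).coeff m = 1 := by simpa [hnat] using hmon.coeff_natDegree
        simp [this]
      · rw [coeff_sub, coeff_smul, hr k hk, coeff_eq_zero_of_natDegree_lt (hnat.trans_lt hk)]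
        simp
    have h0 := ih (fun k hk => hQ k (hk.trans m.lt_succ_self))
      (fun k hk => h k (hk.trans m.lt_succ_self)) hdeg
    rw [← qSkewForm_apply hq0 hω, map_sub, map_smul, qSkewForm_apply, qSkewForm_apply,
      h m m.lt_succ_self, smul_zero, sub_zero] at h0
    exact h0

theorem eq_qSkewPoly {q : ℝ} (hq0 : q ≠ 0) (hq1 : q ≠ 1) {a b : EReal} {ω : ℝ → ℝ}
    (hω : HasJacksonMoments q a b ω) {n : ℕ} (hτ : qTau q a b ω n ≠ 0)
    {p g : ℝ[X]} (hp : (p - g).degree < (2 * n : ℕ))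
    (h : ∀ k < 2 * n, qSkewInner q a b ω p (X ^ k) = 0) : p = qSkewPoly q a b ω n g := by
  refine sub_eq_zero.mp (eq_zero_of_qSkewInner_X_pow_eq_zero hq0 hq1 hω hτ ?_ fun k hk => ?_)
  · have h1 := degree_qSkewPoly_sub_lt hq0 hq1 hω hτ g
    rw [← mem_degreeLT] at hp h1 ⊢
    simpa using Submodule.sub_mem _ hp h1
  · rw [← qSkewForm_apply hq0 hω, map_sub, LinearMap.sub_apply, qSkewForm_apply, qSkewForm_apply,
      h k hk, qSkewInner_qSkewPoly_X_pow hq0 hω g hk, sub_zero]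

/-- Skew orthogonality of a monic sequence amounts to orthogonality of `Q_{2n}` and `Q_{2n+1}`
to all polynomials of degree less than `2n`. -/
theorem isQSkewOrthogonal_iff {q : ℝ} (hq0 : q ≠ 0) {a b : EReal} {ω : ℝ → ℝ}
    (hω : HasJacksonMoments q a b ω) (Q : ℕ → ℝ[X]) :
    IsQSkewOrthogonal q a b ω Q ↔ (∀ n, (Q n).Monic ∧ (Q n).natDegree = n) ∧
      ∀ n, ∀ k < 2 * n, qSkewInner q a b ω (Q (2 * n)) (X ^ k) = 0 ∧
        qSkewInner q a b ω (Q (2 * n + 1)) (X ^ k) = 0 := by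
  constructor
  · rintro ⟨hQ, u, hu⟩
    refine ⟨hQ, fun n k hk => ?_⟩
    have hdeg : (X ^ k : ℝ[X]).degree < (2 * n : ℕ) := by
      rw [degree_X_pow]
      exact_mod_cast hk
    constructor
    · refine qSkewInner_eq_zero_of_degree_lt hq0 hω (fun k _ => hQ k) (fun j hj => ?_) hdeg
      obtain ⟨m, rfl | rfl⟩ := Nat.even_or_odd' j
      · exact (hu n m).2.2.1
      · rw [(hu m n).1, if_neg (by omega)]
    · refine qSkewInner_eq_zero_of_degree_lt hq0 hω (fun k _ => hQ k) (fun j hj => ?_) hdeg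
      obtain ⟨m, rfl | rfl⟩ := Nat.even_or_odd' j
      · rw [(hu n m).2.1, if_neg (by omega), neg_zero]
      · exact (hu n m).2.2.2
  · rintro ⟨hQ, h⟩
    have hX : ∀ m : ℕ, ∀ k < m, (X ^ k : ℝ[X]).Monic ∧ (X ^ k : ℝ[X]).natDegree = k :=
      fun m k _ => ⟨monic_X_pow k, natDegree_X_pow k⟩
    have hdeg : ∀ j m, j < m → (Q j).degree < (m : ℕ) := by
      intro j m hjm
      refine lt_of_le_of_lt degree_le_natDegree ?_
      rw [(hQ j).2]
      exact_mod_cast hjm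
    have he : ∀ n j, j < 2 * n → qSkewInner q a b ω (Q (2 * n)) (Q j) = 0 := fun n j hj =>
      qSkewInner_eq_zero_of_degree_lt hq0 hω (hX _) (fun k hk => (h n k hk).1) (hdeg j _ hj)
    have ho : ∀ n j, j < 2 * n → qSkewInner q a b ω (Q (2 * n + 1)) (Q j) = 0 := fun n j hj =>
      qSkewInner_eq_zero_of_degree_lt hq0 hω (hX _) (fun k hk => (h n k hk).2) (hdeg j _ hj)
    -- For `n ≠ m`, the polynomial with the larger block index is orthogonal to the other, whose
    -- degree is too small. Only `⟨Q_{2n}, Q_{2n+1}⟩` is unconstrained; it serves as `u_n`.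
    have hmixed : ∀ m n, qSkewInner q a b ω (Q (2 * n)) (Q (2 * m + 1)) =
        if n = m then qSkewInner q a b ω (Q (2 * n)) (Q (2 * n + 1)) else 0 := by
      intro m n
      rcases lt_trichotomy n m with hnm | rfl | hnm
      · rw [if_neg hnm.ne, qSkewInner_swap, ho m _ (by omega), neg_zero]
      · rw [if_pos rfl]
      · rw [if_neg hnm.ne', he n _ (by omega)]
    refine ⟨hQ, fun n => qSkewInner q a b ω (Q (2 * n)) (Q (2 * n + 1)), fun m n =>
      ⟨hmixed m n, ?_, ?_, ?_⟩⟩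
    · rw [qSkewInner_swap, hmixed m n]
    · rcases lt_trichotomy n m with hnm | rfl | hnm
      · exact he m _ (by omega)
      · exact qSkewInner_self _ _ _ _ _
      · rw [qSkewInner_swap, he n _ (by omega), neg_zero]
    · rcases lt_trichotomy n m with hnm | rfl | hnm
      · exact ho m _ (by omega)
      · exact qSkewInner_self _ _ _ _ _
      · rw [qSkewInner_swap, ho n _ (by omega), neg_zero]

theorem monic_and_natDegree_eq_of_degree_sub_lt {p g : ℝ[X]} {m : ℕ} (hg : g.Monic)
    (hd : g.natDegree = m) (h : (p - g).degree < m) : p.Monic ∧ p.natDegree = m := by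
  have hgd : g.degree = m := by rw [degree_eq_natDegree hg.ne_zero, hd]
  rw [← hgd] at h
  have hp : p = g + (p - g) := by ring
  rw [hp]
  exact ⟨hg.add_of_left h, by rw [natDegree_add_eq_left_of_degree_lt h, hd]⟩

theorem degree_C_mul_X_pow_lt_succ (c : ℝ) (m : ℕ) :
    (C c * X ^ m : ℝ[X]).degree < (m + 1 : ℕ) :=
  (degree_C_mul_X_pow_le m c).trans_lt (by exact_mod_cast m.lt_succ_self)

end

theorem proposition4p2 (q : ℝ) (hq0 : 0 < q) (hq1 : q < 1) (a b : EReal) (ω : ℝ → ℝ)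
    (hω : HasJacksonMoments q a b ω) (hτ : ∀ n, qTau q a b ω n ≠ 0) :
    (∀ n : ℕ, pfaffian (qMomentMatrix q a b ω n) = q ^ (n * (n - 1)) * qTau q a b ω n) ∧
    ∀ Q : ℕ → Polynomial ℝ, IsQSkewOrthogonal q a b ω Q ↔
      (∀ (n : ℕ) (x : ℝ), (Q (2 * n)).eval x =
        1 / ((n.factorial : ℝ) * qTau q a b ω n) *
          jacksonIntegralPi q a b n fun y =>
            qDelta4 q y * ∏ i, ((x - y i) * (x - q * y i) * ω (y i))) ∧
      ∃ c : ℕ → ℝ, ∀ (n : ℕ) (x : ℝ), (Q (2 * n + 1)).eval x =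
        1 / ((n.factorial : ℝ) * qTau q a b ω n) *
          jacksonIntegralPi q a b n fun y =>
            qDelta4 q y * (x + (1 + q) * (∑ i, y i) + c n) *
              ∏ i, ((x - y i) * (x - q * y i) * ω (y i)) := by
  have hq : q ≠ 0 := hq0.ne'
  refine ⟨pfaffian_qMomentMatrix hq hq1.ne hω, fun Q => ?_⟩
  rw [isQSkewOrthogonal_iff hq hω]
  constructor
  · rintro ⟨hQ, h⟩
    have hcoeff : ∀ m, (Q m).coeff m = 1 := fun m => by
      simpa [(hQ m).2] using (hQ m).1.coeff_natDegree
    have hhigh : ∀ m k, m < k → (Q m).coeff k = 0 := fun m k hk =>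
      coeff_eq_zero_of_natDegree_lt (by rwa [(hQ m).2])
    constructor
    · intro n x
      rw [← eval_qSkewPoly_even hq hq1.ne hω, ← eq_qSkewPoly hq hq1.ne hω (hτ n) _
        fun k hk => (h n k hk).1]
      rw [degree_lt_iff_coeff_zero]
      intro k hk
      rcases hk.eq_or_lt with rfl | hk
      · simp [hcoeff]
      · simp [hhigh _ _ hk, coeff_X_pow, hk.ne']
    -- With this `c_n`, the polynomials `Q_{2n+1}` and `X^(2n+1) + c_n X^(2n)` agree modulo degree
    -- `< 2n`, so uniqueness applies.
    · refine ⟨fun n => (Q (2 * n + 1)).coeff (2 * n), fun n x => ?_⟩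
      rw [← eval_qSkewPoly_odd hq hq1.ne hω, ← eq_qSkewPoly hq hq1.ne hω (hτ n) _
        fun k hk => (h n k hk).2]
      rw [degree_lt_iff_coeff_zero]
      intro k hk
      rcases hk.eq_or_lt with rfl | hk
      · simp [coeff_X_pow]
      · rcases (Nat.succ_le_of_lt hk).eq_or_lt with rfl | hk'
        · simp [hcoeff, coeff_X_pow]
        · simp [hhigh _ _ hk', coeff_X_pow, hk.ne', hk'.ne']
  · rintro ⟨heven, c, hodd⟩
    -- Agreement at every real point identifies the polynomials; degree, monicity and orthogonality
    -- are then read off `qSkewPoly`.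
    have he : ∀ n, Q (2 * n) = qSkewPoly q a b ω n (X ^ (2 * n)) := fun n =>
      Polynomial.funext fun x => by rw [heven, eval_qSkewPoly_even hq hq1.ne hω]
    have ho : ∀ n, Q (2 * n + 1) =
        qSkewPoly q a b ω n (X ^ (2 * n + 1) + C (c n) * X ^ (2 * n)) := fun n =>
      Polynomial.funext fun x => by rw [hodd, eval_qSkewPoly_odd hq hq1.ne hω]
    refine ⟨fun m => ?_, fun n k hk => ?_⟩
    · obtain ⟨n, rfl | rfl⟩ := Nat.even_or_odd' m
      · rw [he]
        exact monic_and_natDegree_eq_of_degree_sub_lt (monic_X_pow _) (natDegree_X_pow _)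
          (degree_qSkewPoly_sub_lt hq hq1.ne hω (hτ n) _)
      · rw [ho]
        have hlt := degree_C_mul_X_pow_lt_succ (c n) (2 * n)
        refine monic_and_natDegree_eq_of_degree_sub_lt (monic_X_pow_add hlt) ?_
          ((degree_qSkewPoly_sub_lt hq hq1.ne hω (hτ n) _).trans
            (by exact_mod_cast (2 * n).lt_succ_self))
        rw [natDegree_add_eq_left_of_degree_lt (by rwa [degree_X_pow]), natDegree_X_pow]
    · rw [he, ho]
      exact ⟨qSkewInner_qSkewPoly_X_pow hq hω _ hk, qSkewInner_qSkewPoly_X_pow hq hω _ hk⟩
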